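/- Let $L^2(0,1)$ be the Hilbert space of complex-valued square-integrable functions on $(0,1)$ and let $\mathcal{H}_1$ be the finite Hardy operator on $L^2(0,1)$, $(\mathcal{H}_1 f)(x)=\frac1x\int_0^x f(t)\,dt$ for $0<x<1$, which is bounded, with adjoint $\mathcal{H}_1^*$. Put $T=I-\mathcal{H}_1^*$ and let $\chi\equiv 1$ on $(0,1)$. A vector $v$ is a frame vector for a bounded operator $T$ on a Hilbert space $H$ if there are constants $c_1,c_2>0$ with $$c_1\|x\|^2\le\sum_{n=0}^\infty|\langle x,T^nv\rangle|^2\le c_2\|x\|^2\qquad\text{for all }x\in H.$$ Let $H^\infty$ be the algebra of bounded analytic functions on the open unit disk $\mathbb{D}$. For $\psi(z)=\sum_{n\ge0}a_nz^n$ in $H^\infty$, the operator $\psi(T)$ is defined by the $H^\infty$ functional calculus, that is, $\psi(T)x=\lim_{r\to1^-}\psi(rT)x$ for every $x\in L^2(0,1)$, where $\psi(rT)=\sum_{n\ge0}a_nr^nT^n$ (absolutely convergent in operator norm for $0\le r<1$). Then $\psi(T)$ exists as a bounded operator on $L^2(0,1)$ for every $\psi\in H^\infty$, and a function $f\in L^2(0,1)$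 is a frame vector for $T=I-\mathcal{H}_1^*$ if and only if there is a $\psi\in H^\infty$, without zeros in $\mathbb{D}$ and with $1/\psi\in H^\infty$, such that $f=\psi(I-\mathcal{H}_1^*)\chi$. -/

import Mathlib

open MeasureTheory Set Filter Topology
open scoped ENNReal InnerProductSpace InnerProduct

noncomputable section

/-- The Lebesgue space `L²(0,1)` of complex-valued functions. -/
abbrev L2Unit : Type := Lp ℂ 2 ((volume : Measure ℝ).restrict (Ioo (0 : ℝ) 1))

/-- The function `x ↦ (1/x) ∫₀ˣ g(t) dt`. -/
def hardyAverage (g : ℝ → ℂ) (x : ℝ) : ℂ := (x : ℂ)⁻¹ * ∫ t in (0 : ℝ)..x, g t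

section HardyInequality

theorem lintegral_rpow_neg_half {x : ℝ} (hx : 0 < x) :
    ∫⁻ t in Ioc (0 : ℝ) x, ENNReal.ofReal (t ^ (-(1 / 2) : ℝ)) =
      ENNReal.ofReal (2 * x ^ (1 / 2 : ℝ)) := by
  have hi : IntegrableOn (fun t : ℝ => t ^ (-(1 / 2) : ℝ)) (Ioc 0 x) := by
    have := intervalIntegral.intervalIntegrable_rpow' (a := 0) (b := x) (r := -(1 / 2))
      (by norm_num)
    rwa [intervalIntegrable_iff_integrableOn_Ioc_of_le hx.le] at this
  rw [← ofReal_integral_eq_lintegral_ofReal hi, ← intervalIntegral.integral_of_le hx.le,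
    integral_rpow (Or.inl (by norm_num))]
  · congr 1
    norm_num
    ring
  · filter_upwards [ae_restrict_mem measurableSet_Ioc] with t ht
    exact Real.rpow_nonneg ht.1.le _

theorem lintegral_rpow_neg_three_half {t : ℝ} (ht : 0 < t) (ht1 : t < 1) :
    ∫⁻ x in Ioc t 1, ENNReal.ofReal (2 * x ^ (-(3 / 2) : ℝ)) ≤
      ENNReal.ofReal (4 * t ^ (-(1 / 2) : ℝ)) := by
  have h0 : (0 : ℝ) ∉ uIcc t 1 := by
    rw [uIcc_of_le ht1.le]; exact fun h => absurd h.1 (not_le.2 ht)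
  have hi : IntegrableOn (fun x : ℝ => 2 * x ^ (-(3 / 2) : ℝ)) (Ioc t 1) := by
    have := (intervalIntegral.intervalIntegrable_rpow (μ := volume) (a := t) (b := 1)
      (r := -(3 / 2)) (Or.inr h0)).const_mul 2
    rwa [intervalIntegrable_iff_integrableOn_Ioc_of_le ht1.le] at this
  rw [← ofReal_integral_eq_lintegral_ofReal hi, ← intervalIntegral.integral_of_le ht1.le,
    intervalIntegral.integral_const_mul, integral_rpow (Or.inr ⟨by norm_num, h0⟩)]
  · apply ENNReal.ofReal_le_ofReal
    norm_num
    linarith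
  · filter_upwards [ae_restrict_mem measurableSet_Ioc] with x hx
    have := Real.rpow_nonneg (ht.trans hx.1).le (-(3 / 2))
    simpa using this

theorem enorm_hardyAverage_sq_le {g : ℝ → ℂ} (hg : StronglyMeasurable g) {x : ℝ} (hx : 0 < x) :
    ‖hardyAverage g x‖ₑ ^ 2 ≤ ENNReal.ofReal (2 * x ^ (-(3 / 2) : ℝ)) *
      ∫⁻ t in Ioc (0 : ℝ) x, ‖g t‖ₑ ^ 2 * ENNReal.ofReal (t ^ (1 / 2 : ℝ)) := by
  have h1 : ‖∫ t in (0 : ℝ)..x, g t‖ₑ ≤ ∫⁻ t in Ioc (0 : ℝ) x, ‖g t‖ₑ := by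
    rw [intervalIntegral.integral_of_le hx.le]
    exact enorm_integral_le_lintegral_enorm _
  have h2 : ∫⁻ t in Ioc (0 : ℝ) x, ‖g t‖ₑ =
      ∫⁻ t in Ioc (0 : ℝ) x, ((fun t => ‖g t‖ₑ * ENNReal.ofReal (t ^ (1 / 4 : ℝ))) *
        fun t => ENNReal.ofReal (t ^ (-(1 / 4) : ℝ))) t := by
    refine setLIntegral_congr_fun measurableSet_Ioc fun t ht => ?_
    simp only [Pi.mul_apply]
    rw [mul_assoc, ← ENNReal.ofReal_mul (Real.rpow_nonneg ht.1.le _), ← Real.rpow_add ht.1]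
    simp
  have hgm : Measurable fun t => ‖g t‖ₑ := hg.measurable.enorm
  have hpow : ∀ s : ℝ, Measurable fun t : ℝ => ENNReal.ofReal (t ^ s) := fun s => by fun_prop
  have h3 := ENNReal.lintegral_mul_le_Lp_mul_Lq (volume.restrict (Ioc (0 : ℝ) x))
    Real.HolderConjugate.two_two
    (f := fun t => ‖g t‖ₑ * ENNReal.ofReal (t ^ (1 / 4 : ℝ)))
    (g := fun t => ENNReal.ofReal (t ^ (-(1 / 4) : ℝ)))
    (hgm.mul (hpow _)).aemeasurable (hpow _).aemeasurable
  rw [← h2] at h3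
  have h4 : (∫⁻ t in Ioc (0 : ℝ) x, ‖g t‖ₑ) ^ 2 ≤
      (∫⁻ t in Ioc (0 : ℝ) x, ‖g t‖ₑ ^ 2 * ENNReal.ofReal (t ^ (1 / 2 : ℝ))) *
        ENNReal.ofReal (2 * x ^ (1 / 2 : ℝ)) := by
    refine (pow_le_pow_left' h3 2).trans_eq ?_
    rw [mul_pow, ← lintegral_rpow_neg_half hx]
    congr 1
    · rw [← ENNReal.rpow_natCast, ← ENNReal.rpow_mul]
      norm_num
      refine setLIntegral_congr_fun measurableSet_Ioc fun t ht => ?_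
      rw [mul_pow, ← ENNReal.ofReal_pow (Real.rpow_nonneg ht.1.le _), ← Real.rpow_natCast,
        ← Real.rpow_mul ht.1.le]
      norm_num
    · rw [← ENNReal.rpow_natCast, ← ENNReal.rpow_mul]
      norm_num
      refine setLIntegral_congr_fun measurableSet_Ioc fun t ht => ?_
      rw [← ENNReal.ofReal_pow (Real.rpow_nonneg ht.1.le _), ← Real.rpow_natCast,
        ← Real.rpow_mul ht.1.le]
      norm_num
  have h5 : ‖(x : ℂ)⁻¹‖ₑ = ENNReal.ofReal (x ^ (-1 : ℝ)) := by
    rw [← ofReal_norm, norm_inv, Complex.norm_real, Real.norm_of_nonneg hx.le,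
      Real.rpow_neg_one]
  calc ‖hardyAverage g x‖ₑ ^ 2
      = ENNReal.ofReal (x ^ (-1 : ℝ)) ^ 2 * ‖∫ t in (0 : ℝ)..x, g t‖ₑ ^ 2 := by
        rw [hardyAverage, enorm_mul, mul_pow, h5]
    _ ≤ ENNReal.ofReal (x ^ (-1 : ℝ)) ^ 2 *
        ((∫⁻ t in Ioc (0 : ℝ) x, ‖g t‖ₑ ^ 2 * ENNReal.ofReal (t ^ (1 / 2 : ℝ))) *
        ENNReal.ofReal (2 * x ^ (1 / 2 : ℝ))) := by
        gcongr
        exact (pow_le_pow_left' h1 2).trans h4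
    _ = _ := by
        rw [mul_comm (∫⁻ _ in _, _), ← mul_assoc, ← ENNReal.ofReal_pow (by positivity),
          ← ENNReal.ofReal_mul (by positivity)]
        congr 2
        rw [← Real.rpow_natCast, ← Real.rpow_mul hx.le, mul_left_comm, ← Real.rpow_add hx]
        norm_num

theorem lintegral_hardyAverage_sq_le {g : ℝ → ℂ} (hg : StronglyMeasurable g) :
    ∫⁻ x in Ioo (0 : ℝ) 1, ‖hardyAverage g x‖ₑ ^ 2 ≤
      4 * ∫⁻ t in Ioo (0 : ℝ) 1, ‖g t‖ₑ ^ 2 := by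
  have hgm : Measurable fun t => ‖g t‖ₑ := hg.measurable.enorm
  set G : ℝ → ℝ≥0∞ := fun t => ‖g t‖ₑ ^ 2 * ENNReal.ofReal (t ^ (1 / 2 : ℝ)) with hG
  have hGm : Measurable G := by fun_prop
  set F : ℝ → ℝ≥0∞ := fun x => ENNReal.ofReal (2 * x ^ (-(3 / 2) : ℝ)) with hF
  have hFm : Measurable F := by fun_prop
  set K : ℝ → ℝ → ℝ≥0∞ := fun x t =>
    {p : ℝ × ℝ | p.2 ≤ p.1}.indicator (fun p => F p.1 * G p.2) (x, t) with hK
  have hKm : Measurable (Function.uncurry K) := by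
    have : Measurable fun p : ℝ × ℝ => F p.1 * G p.2 := by fun_prop
    exact this.indicator (measurableSet_le measurable_snd measurable_fst)
  calc ∫⁻ x in Ioo (0 : ℝ) 1, ‖hardyAverage g x‖ₑ ^ 2
      ≤ ∫⁻ x in Ioo (0 : ℝ) 1, ∫⁻ t in Ioo (0 : ℝ) 1, K x t := by
        refine setLIntegral_mono' measurableSet_Ioo fun x hx => ?_
        refine (enorm_hardyAverage_sq_le hg hx.1).trans ?_
        rw [← lintegral_const_mul _ hGm]
        have hsub : Ioc (0 : ℝ) x ⊆ Ioo 0 1 := fun t ht => ⟨ht.1, ht.2.trans_lt hx.2⟩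
        refine le_trans (le_of_eq ?_) (lintegral_mono_set hsub)
        refine setLIntegral_congr_fun measurableSet_Ioc fun t ht => ?_
        simp [hK, hF, indicator, ht.2]
    _ = ∫⁻ t in Ioo (0 : ℝ) 1, ∫⁻ x in Ioo (0 : ℝ) 1, K x t :=
        lintegral_lintegral_swap hKm.aemeasurable
    _ ≤ ∫⁻ t in Ioo (0 : ℝ) 1, 4 * ‖g t‖ₑ ^ 2 := by
        refine setLIntegral_mono' measurableSet_Ioo fun t ht => ?_
        have e1 : ∫⁻ x in Ioo (0 : ℝ) 1, K x t ≤ ∫⁻ x in Icc t 1, F x * G t := by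
          rw [← lintegral_indicator measurableSet_Ioo, ← lintegral_indicator measurableSet_Icc]
          refine lintegral_mono fun x => ?_
          by_cases hx : x ∈ Ioo (0 : ℝ) 1
          · by_cases htx : t ≤ x
            · simp [hK, indicator, hx.1, hx.2, hx.2.le, htx]
            · simp [hK, indicator, htx]
          · rw [indicator_of_notMem hx]; exact zero_le
        refine e1.trans ?_
        rw [lintegral_mul_const _ hFm, restrict_Ioc_eq_restrict_Icc.symm]
        calc (∫⁻ x in Ioc t 1, F x) * G t
            ≤ ENNReal.ofReal (4 * t ^ (-(1 / 2) : ℝ)) * G t := by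
              gcongr
              exact lintegral_rpow_neg_three_half ht.1 ht.2
          _ = 4 * ‖g t‖ₑ ^ 2 := by
              rw [hG]
              dsimp only
              rw [mul_left_comm, ← ENNReal.ofReal_mul
                (mul_nonneg (by norm_num) (Real.rpow_nonneg ht.1.le _)), mul_assoc,
                ← Real.rpow_add ht.1, mul_comm]
              norm_num
    _ = 4 * ∫⁻ t in Ioo (0 : ℝ) 1, ‖g t‖ₑ ^ 2 := lintegral_const_mul _ (by fun_prop)

theorem intervalIntegrable_L2Unit (f : L2Unit) {x : ℝ} (hx : x ∈ Ioo (0 : ℝ) 1) :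
    IntervalIntegrable f volume 0 x := by
  have h : IntegrableOn f (Ioo (0 : ℝ) 1) := (Lp.memLp f).integrable (by norm_num)
  rw [intervalIntegrable_iff_integrableOn_Ioc_of_le hx.1.le]
  exact h.mono_set fun t ht => ⟨ht.1, ht.2.trans_lt hx.2⟩

theorem eLpNorm_hardyAverage_le (f : L2Unit) :
    eLpNorm (hardyAverage f) 2 (volume.restrict (Ioo (0 : ℝ) 1)) ≤
      2 * eLpNorm f 2 (volume.restrict (Ioo (0 : ℝ) 1)) := by
  have h := lintegral_hardyAverage_sq_le (Lp.stronglyMeasurable f)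
  have h2 : (2 : ℝ≥0∞) = (4 : ℝ≥0∞) ^ (1 / 2 : ℝ) := by
    rw [show (4 : ℝ≥0∞) = 2 ^ (2 : ℝ) by norm_num, ← ENNReal.rpow_mul]
    norm_num
  rw [eLpNorm_eq_lintegral_rpow_enorm_toReal (by norm_num) (by norm_num),
    eLpNorm_eq_lintegral_rpow_enorm_toReal (by norm_num) (by norm_num)]
  simp only [ENNReal.toReal_ofNat, ENNReal.rpow_ofNat]
  refine (ENNReal.rpow_le_rpow h (by norm_num : (0 : ℝ) ≤ 1 / 2)).trans_eq ?_
  rw [ENNReal.mul_rpow_of_nonneg _ _ (by norm_num), ← h2]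

theorem memLp_hardyAverage (f : L2Unit) :
    MemLp (hardyAverage f) 2 (volume.restrict (Ioo (0 : ℝ) 1)) := by
  refine ⟨?_, (eLpNorm_hardyAverage_le f).trans_lt
    (ENNReal.mul_lt_top (by norm_num) (Lp.eLpNorm_lt_top f))⟩
  have h : IntegrableOn f (uIcc (0 : ℝ) 1) := by
    have h : IntegrableOn f (Ioo (0 : ℝ) 1) := (Lp.memLp f).integrable (by norm_num)
    rwa [uIcc_of_le zero_le_one, integrableOn_Icc_iff_integrableOn_Ioo]
  have hc := (intervalIntegral.continuousOn_primitive_interval h).mono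
    (Ioo_subset_Icc_self.trans (uIcc_of_le zero_le_one).ge)
  have hinv : Measurable fun x : ℝ => (x : ℂ)⁻¹ := by fun_prop
  exact hinv.aestronglyMeasurable.mul (hc.aestronglyMeasurable measurableSet_Ioo)

end HardyInequality

/-- The finite Hardy operator `(H₁ f)(x) = (1/x) ∫₀ˣ f(t) dt` as a bounded operator
on `L²(0,1)`. -/
def hardyOperator : L2Unit →L[ℂ] L2Unit :=
  LinearMap.mkContinuous
    { toFun := fun f => (memLp_hardyAverage f).toLp (hardyAverage f)
      map_add' := fun f g => by
        rw [← MemLp.toLp_add, MemLp.toLp_eq_toLp_iff]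
        have hfg := ae_imp_of_ae_restrict (Lp.coeFn_add f g)
        filter_upwards [ae_restrict_mem measurableSet_Ioo] with x hx
        have : ∫ t in (0 : ℝ)..x, (f + g : L2Unit) t = ∫ t in (0 : ℝ)..x, (f t + g t) := by
          refine intervalIntegral.integral_congr_ae ?_
          filter_upwards [hfg] with t ht htx
          rw [uIoc_of_le hx.1.le] at htx
          exact ht ⟨htx.1, htx.2.trans_lt hx.2⟩
        simp only [hardyAverage, Pi.add_apply]
        rw [this, intervalIntegral.integral_add (intervalIntegrable_L2Unit f hx)
          (intervalIntegrable_L2Unit g hx), mul_add]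
      map_smul' := fun c f => by
        rw [RingHom.id_apply, ← MemLp.toLp_const_smul, MemLp.toLp_eq_toLp_iff]
        have hcf := ae_imp_of_ae_restrict (Lp.coeFn_smul c f)
        filter_upwards [ae_restrict_mem measurableSet_Ioo] with x hx
        have : ∫ t in (0 : ℝ)..x, (c • f : L2Unit) t = ∫ t in (0 : ℝ)..x, c • f t := by
          refine intervalIntegral.integral_congr_ae ?_
          filter_upwards [hcf] with t ht htx
          rw [uIoc_of_le hx.1.le] at htx
          exact ht ⟨htx.1, htx.2.trans_lt hx.2⟩
        simp only [hardyAverage, Pi.smul_apply]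
        rw [this, intervalIntegral.integral_smul, smul_eq_mul, smul_eq_mul, mul_left_comm] }
    2 (fun f => by
      simp only [LinearMap.coe_mk, AddHom.coe_mk]
      rw [Lp.norm_toLp, Lp.norm_def]
      have := ENNReal.toReal_mono
        (ENNReal.mul_ne_top (by norm_num) (Lp.eLpNorm_ne_top f)) (eLpNorm_hardyAverage_le f)
      rwa [ENNReal.toReal_mul, ENNReal.toReal_ofNat] at this)

/-- The constant function `χ ≡ 1` in `L²(0,1)`. -/
def chiUnit : L2Unit := Lp.const 2 ((volume : Measure ℝ).restrict (Ioo (0 : ℝ) 1)) (1 : ℂ)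

/-- `v` is a frame vector for `T`: the orbit `(Tⁿ v)` is a frame. -/
def IsFrameVector {H : Type*} [NormedAddCommGroup H] [InnerProductSpace ℂ H]
    (T : H →L[ℂ] H) (v : H) : Prop :=
  ∃ c₁ c₂ : ℝ, 0 < c₁ ∧ 0 < c₂ ∧ ∀ x : H,
    Summable (fun n : ℕ => ‖⟪x, (T ^ n) v⟫_ℂ‖ ^ 2) ∧
    c₁ * ‖x‖ ^ 2 ≤ ∑' n : ℕ, ‖⟪x, (T ^ n) v⟫_ℂ‖ ^ 2 ∧
    ∑' n : ℕ, ‖⟪x, (T ^ n) v⟫_ℂ‖ ^ 2 ≤ c₂ * ‖x‖ ^ 2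

/-- `ψ` restricts to an element of `H^∞`, i.e. it is holomorphic and bounded on the open unit
disk. Values outside the disk are irrelevant. -/
def MemHInfty (ψ : ℂ → ℂ) : Prop :=
  DifferentiableOn ℂ ψ (Metric.ball 0 1) ∧ ∃ C : ℝ, ∀ z ∈ Metric.ball (0 : ℂ) 1, ‖ψ z‖ ≤ C

/-- The `n`-th Taylor coefficient of `ψ` at the origin. -/
def taylorCoeffZero (ψ : ℂ → ℂ) (n : ℕ) : ℂ := iteratedDeriv n ψ 0 / (n.factorial : ℂ)

/-- The operator `A` is the value `ψ(T)` of the `H^∞` functional calculus: with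
`ψ(z) = ∑ aₙ zⁿ`, for each `0 ≤ r < 1` the series `ψ(rT) = ∑ aₙ rⁿ Tⁿ` converges absolutely in
operator norm, and `ψ(rT) → A` in the strong operator topology as `r → 1⁻`. -/
def IsHInftyValue {H : Type*} [NormedAddCommGroup H] [InnerProductSpace ℂ H]
    (ψ : ℂ → ℂ) (T A : H →L[ℂ] H) : Prop :=
  (∀ r : ℝ, 0 ≤ r → r < 1 →
    Summable fun n : ℕ => ‖(taylorCoeffZero ψ n * (r : ℂ) ^ n) • T ^ n‖) ∧
  ∀ x : H, Tendsto
    (fun r : ℝ => (∑' n : ℕ, (taylorCoeffZero ψ n * (r : ℂ) ^ n) • T ^ n) x)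
    (𝓝[<] (1 : ℝ)) (𝓝 (A x))

open Classical in
/-- The operator `ψ(T)` of the `H^∞` functional calculus (`0` if it does not exist). -/
def hInftyCalculus {H : Type*} [NormedAddCommGroup H] [InnerProductSpace ℂ H]
    (ψ : ℂ → ℂ) (T : H →L[ℂ] H) : H →L[ℂ] H :=
  if h : ∃ A : H →L[ℂ] H, IsHInftyValue ψ T A then h.choose else 0

end

/-!
The operator `T = I - H₁*` is an isometry, `χ` is orthogonal to its range, and every monomial
`x ^ (k + 1)` is a Neumann series in the orbit of `χ`, since
`x ^ (k + 1) = χ / (k + 2) + (k + 1) / (k + 2) * T x ^ (k + 1)`. Hence `(Tⁿ χ)` is an orthonormal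
basis along which `T` is the unilateral shift. Reading off coordinates in it identifies the space
with the Hardy space, `T` with multiplication by `z` and `ψ(T)` with multiplication by `ψ`. The
value at `w` of the function `F` belonging to `f` is its inner product with the Szegő kernel `k_w`,
an eigenvector of `T*`. Testing the frame inequalities on `k_w` therefore gives `c₁ ≤ |F(w)|² ≤ c₂`,
so that `F` and `1 / F` lie in `H^∞` and `f = F(T) χ`. Conversely, an invertible `ψ(T)` carries the
orthonormal basis `(Tⁿ χ)` to the orbit of `ψ(T) χ`, which is then a frame.
-/

noncomputable section

section HilbertBasis

variable {ι 𝕜 E F : Type*} [RCLike 𝕜] [NormedAddCommGroup E] [InnerProductSpace 𝕜 E]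

theorem hasSum_norm_inner_hilbertBasis_sq (b : HilbertBasis ι 𝕜 E) (x : E) :
    HasSum (fun i => ‖⟪b i, x⟫_𝕜‖ ^ 2) (‖x‖ ^ 2) := by
  simpa [b.repr_apply_apply] using lp.hasSum_norm (p := 2) (by norm_num) (b.repr x)

theorem ext_inner_hilbertBasis (b : HilbertBasis ι 𝕜 E) {x y : E}
    (h : ∀ i, ⟪b i, x⟫_𝕜 = ⟪b i, y⟫_𝕜) : x = y :=
  b.repr.injective <| lp.ext <| funext fun i => by
    rw [b.repr_apply_apply, b.repr_apply_apply, h]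

theorem dense_span_range_hilbertBasis (b : HilbertBasis ι 𝕜 E) :
    Dense (Submodule.span 𝕜 (range b) : Set E) :=
  Submodule.dense_iff_topologicalClosure_eq_top.2 b.dense_span

theorem continuousLinearMap_ext_hilbertBasis [NormedAddCommGroup F] [NormedSpace 𝕜 F]
    (b : HilbertBasis ι 𝕜 E) {A B : E →L[𝕜] F} (h : ∀ i, A (b i) = B (b i)) : A = B :=
  ContinuousLinearMap.ext_on (dense_span_range_hilbertBasis b) <| forall_mem_range.2 h

theorem inner_eq_of_hasSum_smul_orthonormal {v : ι → E} (hv : Orthonormal 𝕜 v) {c : ι → 𝕜} {x : E}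
    (hx : HasSum (fun i => c i • v i) x) (i : ι) : ⟪v i, x⟫_𝕜 = c i := by
  classical
  refine (hx.mapL (innerSL 𝕜 (v i))).unique ((hasSum_ite_eq i (c i)).congr_fun fun j => ?_)
  rw [innerSL_apply_apply, inner_smul_right, orthonormal_iff_ite.1 hv]
  aesop

/-- The isometry that carries the Hilbert basis `b` onto the orthonormal family `v`. -/
def basisIsometry [NormedAddCommGroup F] [InnerProductSpace 𝕜 F] [CompleteSpace F]
    (b : HilbertBasis ι 𝕜 E) {v : ι → F} (hv : Orthonormal 𝕜 v) : E →ₗᵢ[𝕜] F :=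
  hv.orthogonalFamily.linearIsometry.comp b.repr.toLinearIsometry

theorem basisIsometry_apply_basis [NormedAddCommGroup F] [InnerProductSpace 𝕜 F]
    [CompleteSpace F] (b : HilbertBasis ι 𝕜 E) {v : ι → F} (hv : Orthonormal 𝕜 v) (i : ι) :
    basisIsometry b hv (b i) = v i := by
  classical
  change hv.orthogonalFamily.linearIsometry (b.repr (b i)) = v i
  rw [b.repr_self, OrthogonalFamily.linearIsometry_apply_single,
    LinearIsometry.toSpanSingleton_apply, one_smul]

theorem tendsto_of_tendsto_inner_hilbertBasis_of_dominated {α : Type*} {l : Filter α}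
    (b : HilbertBasis ι 𝕜 E) {u : α → E} {y : E} {g : ι → ℝ} (hg : Summable fun i => g i ^ 2)
    (hu : ∀ i, Tendsto (fun a => ⟪b i, u a⟫_𝕜) l (𝓝 ⟪b i, y⟫_𝕜))
    (hbound : ∀ᶠ a in l, ∀ i, ‖⟪b i, u a - y⟫_𝕜‖ ≤ g i) : Tendsto u l (𝓝 y) := by
  have hcoord (i : ι) : Tendsto (fun a => ‖⟪b i, u a - y⟫_𝕜‖ ^ 2) l (𝓝 0) := by
    simpa [inner_sub_right] using ((hu i).sub_const ⟪b i, y⟫_𝕜).norm.pow 2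
  have hsq : Tendsto (fun a => ‖u a - y‖ ^ 2) l (𝓝 0) := by
    simp only [← (hasSum_norm_inner_hilbertBasis_sq b _).tsum_eq]
    rw [← tsum_zero (α := ℝ) (β := ι)]
    refine tendsto_tsum_of_dominated_convergence hg hcoord ?_
    filter_upwards [hbound] with a ha i
    rw [norm_pow, norm_norm]
    exact pow_le_pow_left₀ (norm_nonneg _) (ha i) 2
  rw [tendsto_iff_norm_sub_tendsto_zero]
  simpa using hsq.sqrt

end HilbertBasis

section StrongConvergence

variable {α 𝕜 E F : Type*} [NontriviallyNormedField 𝕜] [NormedAddCommGroup E] [NormedSpace 𝕜 E]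
  [NormedAddCommGroup F] [NormedSpace 𝕜 F] {l : Filter α} {B : α → E →L[𝕜] F} {C : ℝ}

theorem exists_tendsto_of_mem_span {s : Set E} (h : ∀ x ∈ s, ∃ y, Tendsto (B · x) l (𝓝 y)) {x : E}
    (hx : x ∈ Submodule.span 𝕜 s) : ∃ y, Tendsto (B · x) l (𝓝 y) := by
  induction hx using Submodule.span_induction with
  | mem x hx => exact h x hx
  | zero => exact ⟨0, by simpa using tendsto_const_nhds⟩
  | add x₁ x₂ _ _ h₁ h₂ =>
    obtain ⟨y₁, hy₁⟩ := h₁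
    obtain ⟨y₂, hy₂⟩ := h₂
    exact ⟨y₁ + y₂, by simpa using hy₁.add hy₂⟩
  | smul c x _ h =>
    obtain ⟨y, hy⟩ := h
    exact ⟨c • y, by simpa using hy.const_smul c⟩

theorem exists_tendsto_of_mem_closure [CompleteSpace F] [l.NeBot] (hB : ∀ᶠ a in l, ‖B a‖ ≤ C)
    {s : Set E} (h : ∀ x ∈ s, ∃ y, Tendsto (B · x) l (𝓝 y)) {x : E} (hx : x ∈ closure s) :
    ∃ y, Tendsto (B · x) l (𝓝 y) := by
  have hC : 0 ≤ C := let ⟨a, ha⟩ := hB.exists; (norm_nonneg _).trans ha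
  rw [← cauchy_map_iff_exists_tendsto, Metric.cauchy_iff]
  refine ⟨inferInstance, fun ε hε => ?_⟩
  obtain ⟨x', hx', hxx'⟩ := Metric.mem_closure_iff.1 hx (ε / (4 * (C + 1))) (by positivity)
  obtain ⟨y, hy⟩ := h x' hx'
  have hnear : ∀ᶠ a in l, dist (B a x) y < ε / 2 := by
    filter_upwards [hB, Metric.tendsto_nhds.1 hy (ε / 4) (by positivity)] with a hBa ha
    have hBx : dist (B a x) (B a x') ≤ ε / 4 :=
      calc dist (B a x) (B a x') = ‖B a (x - x')‖ := by rw [dist_eq_norm, map_sub]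
        _ ≤ C * ‖x - x'‖ := (B a).le_of_opNorm_le hBa _
        _ ≤ (C + 1) * (ε / (4 * (C + 1))) := by
          rw [← dist_eq_norm]
          gcongr
          linarith
        _ = ε / 4 := by field_simp
    linarith [dist_triangle (B a x) (B a x') y]
  refine ⟨Metric.ball y (ε / 2), hnear, fun u hu v hv => ?_⟩
  rw [Metric.mem_ball] at hu hv
  linarith [dist_triangle_right u v y]

end StrongConvergence

section ContinuousMultiplier

variable {X 𝕜 : Type*} [TopologicalSpace X] [CompactSpace X] [MeasurableSpace X] [BorelSpace X]
  [RCLike 𝕜] (p : ℝ≥0∞) [Fact (1 ≤ p)] (μ : Measure X) [IsFiniteMeasure μ]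

/-- Multiplication by a continuous function as a bounded operator on `Lᵖ`. -/
def continuousMultiplier : C(X, 𝕜) →L[𝕜] Lp 𝕜 p μ →L[𝕜] Lp 𝕜 p μ :=
  ((ContinuousLinearMap.mul 𝕜 𝕜).holderL μ ∞ p p).comp (ContinuousMap.toLp ∞ μ 𝕜)

theorem coeFn_continuousMultiplier (g : C(X, 𝕜)) (f : Lp 𝕜 p μ) :
    continuousMultiplier p μ g f =ᵐ[μ] fun x => g x * f x := by
  refine (ContinuousLinearMap.coeFn_holder (r := p) (ContinuousLinearMap.mul 𝕜 𝕜) _ f).trans ?_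
  filter_upwards [ContinuousMap.coeFn_toLp (p := ∞) (𝕜 := 𝕜) μ g] with x hx
  exact congrArg (· * f x) hx

theorem norm_continuousMultiplier_le (g : C(X, 𝕜)) : ‖continuousMultiplier p μ g‖ ≤ ‖g‖ := by
  refine ContinuousLinearMap.opNorm_le_bound _ (norm_nonneg _) fun f => ?_
  have hg : ‖ContinuousMap.toLp (E := 𝕜) ∞ μ 𝕜 g‖ ≤ ‖g‖ := by
    simpa using (ContinuousMap.toLp (E := 𝕜) ∞ μ 𝕜).le_of_opNorm_le
      (ContinuousMap.toLp_norm_le (p := ∞) (E := 𝕜) (𝕜 := 𝕜) μ) g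
  refine (ContinuousLinearMap.norm_holder_apply_apply_le (r := p) (ContinuousLinearMap.mul 𝕜 𝕜)
    (ContinuousMap.toLp (E := 𝕜) ∞ μ 𝕜 g) f).trans ?_
  rw [ContinuousLinearMap.opNorm_mul, one_mul]
  gcongr

end ContinuousMultiplier

section FourierSeries

variable {c : ℕ → ℂ} {C : ℝ}

theorem orthonormal_fourierLp_nat : Orthonormal ℂ fun n : ℕ => fourierLp (T := 1) 2 (n : ℤ) :=
  orthonormal_fourier.comp _ Nat.cast_injective

theorem continuousMultiplier_fourier_fourierLp (m n : ℤ) :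
    continuousMultiplier 2 (AddCircle.haarAddCircle (T := 1)) (fourier m) (fourierLp 2 n) =
      fourierLp 2 (m + n) := by
  refine Lp.ext ((coeFn_continuousMultiplier ..).trans ?_)
  filter_upwards [coeFn_fourierLp (T := 1) 2 n, coeFn_fourierLp (T := 1) 2 (m + n)] with x hn hmn
  rw [hn, hmn, fourier_add]

/-- The continuous function `∑ cₙ zⁿ` on the unit circle, for an absolutely summable sequence `c`;
its Fourier coefficients of negative index vanish. -/
def analyticFourierSeries (c : ℕ → ℂ) : C(AddCircle (1 : ℝ), ℂ) := ∑' n : ℕ, c n • fourier (n : ℤ)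

theorem hasSum_analyticFourierSeries (hc : Summable fun n => ‖c n‖) :
    HasSum (fun n : ℕ => c n • fourier (T := 1) (n : ℤ)) (analyticFourierSeries c) :=
  (Summable.of_norm (by simpa only [norm_smul, fourier_norm, mul_one] using hc)).hasSum

theorem norm_analyticFourierSeries_le (hc : Summable fun n => ‖c n‖)
    (hC : ∀ z : ℂ, ‖z‖ = 1 → ‖∑' n, c n * z ^ n‖ ≤ C) : ‖analyticFourierSeries c‖ ≤ C := by
  refine (ContinuousMap.norm_le _ ((norm_nonneg _).trans (hC 1 norm_one))).2 fun x => ?_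
  rw [analyticFourierSeries, ← ContinuousMap.tsum_apply (hasSum_analyticFourierSeries hc).summable]
  simpa [fourier_apply, AddCircle.toCircle_nsmul] using
    hC (AddCircle.toCircle x) (Circle.norm_coe _)

theorem sum_sq_norm_le_of_norm_tsum_mul_pow_le (hc : Summable fun n => ‖c n‖)
    (hC : ∀ z : ℂ, ‖z‖ = 1 → ‖∑' n, c n * z ^ n‖ ≤ C) (s : Finset ℕ) :
    ∑ n ∈ s, ‖c n‖ ^ 2 ≤ C ^ 2 := by
  set G := ContinuousMap.toLp (E := ℂ) 2 (AddCircle.haarAddCircle (T := 1)) ℂ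
    (analyticFourierSeries c)
  have hsum : HasSum (fun n : ℕ => c n • fourierLp (T := 1) 2 (n : ℤ)) G := by
    simpa only [map_smul] using (hasSum_analyticFourierSeries hc).mapL (ContinuousMap.toLp 2 _ ℂ)
  have hG : ‖G‖ ≤ C := by
    simpa [measureUnivNNReal] using ContinuousLinearMap.le_of_opNorm_le_of_le _
      (ContinuousMap.toLp_norm_le (p := 2) (E := ℂ) (𝕜 := ℂ) (AddCircle.haarAddCircle (T := 1)))
      (norm_analyticFourierSeries_le hc hC)
  calc ∑ n ∈ s, ‖c n‖ ^ 2 = ∑ n ∈ s, ‖⟪fourierLp (T := 1) 2 (n : ℤ), G⟫_ℂ‖ ^ 2 := by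
        simp only [inner_eq_of_hasSum_smul_orthonormal orthonormal_fourierLp_nat hsum]
    _ ≤ ‖G‖ ^ 2 := orthonormal_fourierLp_nat.sum_inner_products_le _
    _ ≤ C ^ 2 := by gcongr

end FourierSeries

section ContractionPowers

variable {𝕜 E : Type*} [NontriviallyNormedField 𝕜] [NormedAddCommGroup E] [NormedSpace 𝕜 E]
  {T : E →L[𝕜] E}

theorem norm_contraction_pow_le (hT : ‖T‖ ≤ 1) (n : ℕ) : ‖T ^ n‖ ≤ 1 := by
  induction n with
  | zero => exact ContinuousLinearMap.norm_id_le
  | succ n ih =>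
    rw [pow_succ]
    exact (norm_mul_le _ _).trans (mul_le_one₀ ih (norm_nonneg _) hT)

theorem summable_norm_smul_contraction_pow (hT : ‖T‖ ≤ 1) {c : ℕ → 𝕜}
    (hc : Summable fun n => ‖c n‖) : Summable fun n => ‖c n • T ^ n‖ := by
  refine hc.of_nonneg_of_le (fun _ => norm_nonneg _) fun n => ?_
  rw [norm_smul]
  exact mul_le_of_le_one_right (norm_nonneg _) (norm_contraction_pow_le hT n)

end ContractionPowers

section UnilateralShift

variable {H : Type*} [NormedAddCommGroup H] [InnerProductSpace ℂ H]

/-- `T` is the unilateral shift of multiplicity one along the Hilbert basis `b`. -/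
def IsUnilateralShift (b : HilbertBasis ℕ ℂ H) (T : H →L[ℂ] H) : Prop :=
  ∀ n, T (b n) = b (n + 1)

variable {b : HilbertBasis ℕ ℂ H} {T : H →L[ℂ] H}

theorem IsUnilateralShift.pow_apply_basis (hT : IsUnilateralShift b T) (n m : ℕ) :
    (T ^ n) (b m) = b (m + n) := by
  induction n with
  | zero => rw [pow_zero, one_apply_eq_self, add_zero]
  | succ n ih => rw [pow_succ', mul_apply_eq_comp, ih, hT, add_assoc]

theorem IsUnilateralShift.norm_le_one [CompleteSpace H] (hT : IsUnilateralShift b T) :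
    ‖T‖ ≤ 1 := by
  set V := basisIsometry b (b.orthonormal.comp _ Nat.succ_injective)
  have hTV : T = V.toContinuousLinearMap := continuousLinearMap_ext_hilbertBasis b fun n => by
    rw [hT, LinearIsometry.coe_toContinuousLinearMap, basisIsometry_apply_basis]
    rfl
  rw [hTV]
  exact LinearIsometry.norm_toContinuousLinearMap_le _

theorem IsUnilateralShift.basisIsometry_pow_apply (hT : IsUnilateralShift b T) (n : ℕ) (x : H) :
    basisIsometry b orthonormal_fourierLp_nat ((T ^ n) x) =
      continuousMultiplier 2 _ (fourier (n : ℤ)) (basisIsometry b orthonormal_fourierLp_nat x) := by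
  set U := (basisIsometry b orthonormal_fourierLp_nat).toContinuousLinearMap
  suffices h : U.comp (T ^ n) = (continuousMultiplier 2 _ (fourier (n : ℤ))).comp U from
    DFunLike.congr_fun h x
  refine continuousLinearMap_ext_hilbertBasis b fun m => ?_
  simp only [U, ContinuousLinearMap.comp_apply, LinearIsometry.coe_toContinuousLinearMap,
    hT.pow_apply_basis, basisIsometry_apply_basis, continuousMultiplier_fourier_fourierLp]
  rw [Nat.cast_add, add_comm]

/-- Von Neumann's inequality for the shift, by realizing `T` as multiplication by `z` on `L²(𝕋)`. -/
theorem IsUnilateralShift.norm_tsum_smul_pow_le [CompleteSpace H] (hT : IsUnilateralShift b T)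
    {c : ℕ → ℂ} (hc : Summable fun n => ‖c n‖) {C : ℝ}
    (hC : ∀ z : ℂ, ‖z‖ = 1 → ‖∑' n, c n * z ^ n‖ ≤ C) : ‖∑' n, c n • T ^ n‖ ≤ C := by
  set U := basisIsometry b orthonormal_fourierLp_nat
  set M := continuousMultiplier (𝕜 := ℂ) 2 (AddCircle.haarAddCircle (T := 1))
  have hM : ‖M (analyticFourierSeries c)‖ ≤ C :=
    (norm_continuousMultiplier_le _ _ _).trans (norm_analyticFourierSeries_le hc hC)
  refine ContinuousLinearMap.opNorm_le_bound _ ((norm_nonneg _).trans hM) fun x => ?_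
  have hsum : HasSum (fun n => U ((c n • T ^ n) x)) (U ((∑' n, c n • T ^ n) x)) :=
    ((summable_norm_smul_contraction_pow hT.norm_le_one hc).of_norm.hasSum.mapL
      (ContinuousLinearMap.apply ℂ H x)).mapL U.toContinuousLinearMap
  have hUM : U ((∑' n, c n • T ^ n) x) = M (analyticFourierSeries c) (U x) := by
    refine hsum.unique ((((hasSum_analyticFourierSeries hc).mapL M).mapL
      (ContinuousLinearMap.apply ℂ _ (U x))).congr_fun fun n => ?_)
    rw [map_smul, map_smul, ContinuousLinearMap.apply_apply, ← hT.basisIsometry_pow_apply,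
      ← map_smul]
    rfl
  calc ‖(∑' n, c n • T ^ n) x‖ = ‖M (analyticFourierSeries c) (U x)‖ := by rw [← hUM, U.norm_map]
    _ ≤ C * ‖U x‖ := (M _).le_of_opNorm_le hM _
    _ = C * ‖x‖ := by rw [U.norm_map]

end UnilateralShift

section SzegoKernel

variable {H : Type*} [NormedAddCommGroup H] [InnerProductSpace ℂ H]

/-- The Szegő kernel `∑ w̄ⁿ bₙ` at the point `w` of the unit disk; if `b` is the basis of monomials
of the Hardy space, then `⟪szegoKernel b w, x⟫` is the value `x(w)`. -/
def szegoKernel (b : HilbertBasis ℕ ℂ H) (w : ℂ) : H := ∑' n, (starRingEnd ℂ w) ^ n • b n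

variable [CompleteSpace H] {b : HilbertBasis ℕ ℂ H} {w : ℂ}

theorem hasSum_szegoKernel (hw : ‖w‖ < 1) :
    HasSum (fun n => (starRingEnd ℂ w) ^ n • b n) (szegoKernel b w) := by
  refine (Summable.of_norm ?_).hasSum
  simpa [norm_smul, b.orthonormal.1] using summable_geometric_of_lt_one (norm_nonneg w) hw

theorem inner_szegoKernel_basis (hw : ‖w‖ < 1) (n : ℕ) : ⟪szegoKernel b w, b n⟫_ℂ = w ^ n := by
  rw [← inner_conj_symm, inner_eq_of_hasSum_smul_orthonormal b.orthonormal (hasSum_szegoKernel hw),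
    map_pow, Complex.conj_conj]

theorem szegoKernel_ne_zero (hw : ‖w‖ < 1) : szegoKernel b w ≠ 0 := fun h => by
  simpa [h] using inner_szegoKernel_basis (b := b) hw 0

theorem hasFPowerSeriesOnBall_inner_szegoKernel (x : H) :
    HasFPowerSeriesOnBall (fun w => ⟪szegoKernel b w, x⟫_ℂ)
      (FormalMultilinearSeries.ofScalars ℂ fun n => ⟪b n, x⟫_ℂ) 0 1 where
  r_le := by
    refine FormalMultilinearSeries.le_radius_of_bound (r := 1) _ ‖x‖ fun n => ?_
    rw [FormalMultilinearSeries.ofScalars_norm]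
    simpa [b.orthonormal.1] using norm_inner_le_norm (𝕜 := ℂ) (b n) x
  r_pos := one_pos
  hasSum := fun {w} hw => by
    have hw' : ‖w‖ < 1 := by simpa [← ofReal_norm] using hw
    rw [zero_add]
    refine (b.hasSum_inner_mul_inner (szegoKernel b w) x).congr_fun fun n => ?_
    rw [inner_szegoKernel_basis hw', FormalMultilinearSeries.ofScalars_apply_eq, smul_eq_mul,
      mul_comm]

theorem differentiableOn_inner_szegoKernel (x : H) :
    DifferentiableOn ℂ (fun w => ⟪szegoKernel b w, x⟫_ℂ) (Metric.ball 0 1) := by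
  rw [← NNReal.coe_one, ← Metric.eball_coe, ENNReal.coe_one]
  exact (hasFPowerSeriesOnBall_inner_szegoKernel x).differentiableOn

theorem ext_inner_szegoKernel {x y : H}
    (h : ∀ w : ℂ, ‖w‖ < 1 → ⟪szegoKernel b w, x⟫_ℂ = ⟪szegoKernel b w, y⟫_ℂ) : x = y := by
  have hxy : (fun w => ⟪szegoKernel b w, x⟫_ℂ) =ᶠ[𝓝 0] fun w => ⟪szegoKernel b w, y⟫_ℂ := by
    filter_upwards [Metric.ball_mem_nhds (0 : ℂ) one_pos] with w hw
    exact h w (mem_ball_zero_iff.1 hw)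
  have hseries := ((hasFPowerSeriesOnBall_inner_szegoKernel x).hasFPowerSeriesAt.congr
    hxy).eq_formalMultilinearSeries (hasFPowerSeriesOnBall_inner_szegoKernel y).hasFPowerSeriesAt
  exact ext_inner_hilbertBasis b
    (congrFun (FormalMultilinearSeries.ofScalars_series_injective ℂ ℂ hseries))

theorem IsUnilateralShift.inner_szegoKernel_apply {T : H →L[ℂ] H} (hT : IsUnilateralShift b T)
    (hw : ‖w‖ < 1) (x : H) : ⟪szegoKernel b w, T x⟫_ℂ = w * ⟪szegoKernel b w, x⟫_ℂ := by
  suffices h : (innerSL ℂ (szegoKernel b w)).comp T = w • innerSL ℂ (szegoKernel b w) from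
    DFunLike.congr_fun h x
  refine continuousLinearMap_ext_hilbertBasis b fun n => ?_
  rw [ContinuousLinearMap.comp_apply, hT, FunLike.coe_smul, Pi.smul_apply, innerSL_apply_apply,
    innerSL_apply_apply, inner_szegoKernel_basis hw, inner_szegoKernel_basis hw, smul_eq_mul,
    pow_succ']

end SzegoKernel

section EigenvectorOfAdjoint

variable {𝕜 E : Type*} [RCLike 𝕜] [NormedAddCommGroup E] [InnerProductSpace 𝕜 E]

theorem inner_pow_apply_of_inner_apply {T : E →L[𝕜] E} {k : E} {w : 𝕜}
    (hk : ∀ x, ⟪k, T x⟫_𝕜 = w * ⟪k, x⟫_𝕜) (n : ℕ) (x : E) :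
    ⟪k, (T ^ n) x⟫_𝕜 = w ^ n * ⟪k, x⟫_𝕜 := by
  induction n with
  | zero => rw [pow_zero, pow_zero, one_apply_eq_self, one_mul]
  | succ n ih => rw [pow_succ', mul_apply_eq_comp, hk, ih, ← mul_assoc, pow_succ']

end EigenvectorOfAdjoint

section TaylorCoefficients

variable {ψ : ℂ → ℂ} {r : ℝ}

theorem norm_ofReal_mul_lt_one (hr : r ∈ Ico (0 : ℝ) 1) {z : ℂ} (hz : ‖z‖ ≤ 1) :
    ‖(r : ℂ) * z‖ < 1 := by
  rw [norm_mul, Complex.norm_of_nonneg hr.1]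
  exact (mul_le_of_le_one_right hr.1 hz).trans_lt hr.2

theorem hasSum_taylorCoeffZero_mul_pow (hψ : DifferentiableOn ℂ ψ (Metric.ball 0 1))
    (hr : r ∈ Ico (0 : ℝ) 1) {z : ℂ} (hz : ‖z‖ ≤ 1) :
    HasSum (fun n => taylorCoeffZero ψ n * (r : ℂ) ^ n * z ^ n) (ψ (r * z)) := by
  have hrz : (r : ℂ) * z ∈ Metric.ball (0 : ℂ) 1 :=
    mem_ball_zero_iff.2 (norm_ofReal_mul_lt_one hr hz)
  refine (Complex.hasSum_taylorSeries_on_ball (r := 1) (by simpa using hψ)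
    (by simpa using hrz)).congr_fun fun n => ?_
  rw [taylorCoeffZero, sub_zero, smul_eq_mul, smul_eq_mul]
  ring

theorem summable_norm_taylorCoeffZero_mul_pow (hψ : DifferentiableOn ℂ ψ (Metric.ball 0 1))
    (hr : r ∈ Ico (0 : ℝ) 1) : Summable fun n => ‖taylorCoeffZero ψ n * (r : ℂ) ^ n‖ := by
  simpa using (hasSum_taylorCoeffZero_mul_pow hψ hr (z := 1) (by simp)).summable.norm

theorem norm_tsum_taylorCoeffZero_mul_pow_le (hψ : DifferentiableOn ℂ ψ (Metric.ball 0 1)) {C : ℝ}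
    (hC : ∀ z ∈ Metric.ball (0 : ℂ) 1, ‖ψ z‖ ≤ C) (hr : r ∈ Ico (0 : ℝ) 1) {z : ℂ}
    (hz : ‖z‖ ≤ 1) : ‖∑' n, taylorCoeffZero ψ n * (r : ℂ) ^ n * z ^ n‖ ≤ C := by
  rw [(hasSum_taylorCoeffZero_mul_pow hψ hr hz).tsum_eq]
  exact hC _ (mem_ball_zero_iff.2 (norm_ofReal_mul_lt_one hr hz))

theorem tendsto_mul_ofReal_pow_nhdsLT_one (c : ℂ) (n : ℕ) :
    Tendsto (fun r : ℝ => c * (r : ℂ) ^ n) (𝓝[<] 1) (𝓝 c) := by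
  have hcont : Continuous fun r : ℝ => c * (r : ℂ) ^ n := by fun_prop
  simpa using (hcont.tendsto 1).mono_left nhdsWithin_le_nhds

theorem MemHInfty.summable_sq_norm_taylorCoeffZero (hψ : MemHInfty ψ) :
    Summable fun n => ‖taylorCoeffZero ψ n‖ ^ 2 := by
  obtain ⟨hd, C, hC⟩ := hψ
  refine summable_of_sum_le (c := C ^ 2) (fun n => by positivity) fun s => ?_
  refine le_of_tendsto (tendsto_finsetSum s fun n _ =>
    (tendsto_mul_ofReal_pow_nhdsLT_one (taylorCoeffZero ψ n) n).norm.pow 2) ?_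
  filter_upwards [Ico_mem_nhdsLT zero_lt_one] with r hr
  exact sum_sq_norm_le_of_norm_tsum_mul_pow_le (summable_norm_taylorCoeffZero_mul_pow hd hr)
    (fun z hz => norm_tsum_taylorCoeffZero_mul_pow_le hd hC hr hz.le) s

end TaylorCoefficients

section HInftyCalculus

variable {H : Type*} [NormedAddCommGroup H] [InnerProductSpace ℂ H] {T : H →L[ℂ] H} {ψ : ℂ → ℂ}
  {r : ℝ}

/-- The operator `ψ(rT) = ∑ aₙ rⁿ Tⁿ`, whose strong limit as `r → 1⁻` is `ψ(T)`. -/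
def hInftyDilation (ψ : ℂ → ℂ) (T : H →L[ℂ] H) (r : ℝ) : H →L[ℂ] H :=
  ∑' n : ℕ, (taylorCoeffZero ψ n * (r : ℂ) ^ n) • T ^ n

theorem isHInftyValue_hInftyCalculus (h : ∃ A, IsHInftyValue ψ T A) :
    IsHInftyValue ψ T (hInftyCalculus ψ T) := by
  rw [hInftyCalculus, dif_pos h]
  exact h.choose_spec

theorem IsHInftyValue.inner_apply_of_inner_apply [CompleteSpace H] {A : H →L[ℂ] H}
    (hA : IsHInftyValue ψ T A) (hψ : DifferentiableOn ℂ ψ (Metric.ball 0 1)) {k : H} {w : ℂ}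
    (hw : ‖w‖ < 1) (hk : ∀ x, ⟪k, T x⟫_ℂ = w * ⟪k, x⟫_ℂ) (x : H) :
    ⟪k, A x⟫_ℂ = ψ w * ⟪k, x⟫_ℂ := by
  have hcont : ContinuousAt ψ w :=
    (hψ.differentiableAt (Metric.isOpen_ball.mem_nhds (mem_ball_zero_iff.2 hw))).continuousAt
  have hrw : Tendsto (fun r : ℝ => (r : ℂ) * w) (𝓝[<] 1) (𝓝 w) := by
    simpa only [pow_one, mul_comm w] using tendsto_mul_ofReal_pow_nhdsLT_one w 1
  refine tendsto_nhds_unique (tendsto_const_nhds.inner (hA.2 x))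
    (((hcont.tendsto.comp hrw).mul_const ⟪k, x⟫_ℂ).congr' ?_)
  filter_upwards [Ico_mem_nhdsLT zero_lt_one] with r hr
  have hsum := ((hA.1 r hr.1 hr.2).of_norm.hasSum.mapL
    (ContinuousLinearMap.apply ℂ H x)).mapL (innerSL ℂ k)
  refine ((hasSum_taylorCoeffZero_mul_pow hψ hr hw.le).mul_right _).unique
    (hsum.congr_fun fun n => ?_)
  rw [map_smul, map_smul, ContinuousLinearMap.apply_apply, innerSL_apply_apply,
    inner_pow_apply_of_inner_apply hk, smul_eq_mul, mul_assoc]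

variable [CompleteSpace H]

theorem hInftyDilation_commute_pow (hs : Summable fun n : ℕ =>
    ‖(taylorCoeffZero ψ n * (r : ℂ) ^ n) • T ^ n‖) (k : ℕ) :
    Commute (hInftyDilation ψ T r) (T ^ k) :=
  (hs.of_norm.hasSum.mul_right (T ^ k)).unique <|
    (hs.of_norm.hasSum.mul_left (T ^ k)).congr_fun fun n =>
      ((Commute.pow_pow_self T n k).smul_left _).eq

variable {b : HilbertBasis ℕ ℂ H}

theorem IsUnilateralShift.summable_norm_taylorCoeffZero_smul_pow (hT : IsUnilateralShift b T)
    (hψ : DifferentiableOn ℂ ψ (Metric.ball 0 1)) (hr : r ∈ Ico (0 : ℝ) 1) :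
    Summable fun n => ‖(taylorCoeffZero ψ n * (r : ℂ) ^ n) • T ^ n‖ :=
  summable_norm_smul_contraction_pow hT.norm_le_one (summable_norm_taylorCoeffZero_mul_pow hψ hr)

theorem IsUnilateralShift.norm_hInftyDilation_le (hT : IsUnilateralShift b T)
    (hψ : DifferentiableOn ℂ ψ (Metric.ball 0 1)) {C : ℝ}
    (hC : ∀ z ∈ Metric.ball (0 : ℂ) 1, ‖ψ z‖ ≤ C) (hr : r ∈ Ico (0 : ℝ) 1) :
    ‖hInftyDilation ψ T r‖ ≤ C :=
  hT.norm_tsum_smul_pow_le (summable_norm_taylorCoeffZero_mul_pow hψ hr) fun _ hz =>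
    norm_tsum_taylorCoeffZero_mul_pow_le hψ hC hr hz.le

theorem IsUnilateralShift.inner_basis_hInftyDilation (hT : IsUnilateralShift b T)
    (hψ : DifferentiableOn ℂ ψ (Metric.ball 0 1)) (hr : r ∈ Ico (0 : ℝ) 1) (n : ℕ) :
    ⟪b n, hInftyDilation ψ T r (b 0)⟫_ℂ = taylorCoeffZero ψ n * (r : ℂ) ^ n := by
  refine inner_eq_of_hasSum_smul_orthonormal (c := fun n => taylorCoeffZero ψ n * (r : ℂ) ^ n)
    b.orthonormal ?_ n
  refine ((hT.summable_norm_taylorCoeffZero_smul_pow hψ hr).of_norm.hasSum.mapL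
    (ContinuousLinearMap.apply ℂ H (b 0))).congr_fun fun n => ?_
  rw [map_smul, ContinuousLinearMap.apply_apply, hT.pow_apply_basis, zero_add]

theorem IsUnilateralShift.exists_tendsto_hInftyDilation_basis_zero (hT : IsUnilateralShift b T)
    (hψ : MemHInfty ψ) :
    ∃ y, Tendsto (fun r => hInftyDilation ψ T r (b 0)) (𝓝[<] 1) (𝓝 y) := by
  have hmem : Memℓp (taylorCoeffZero ψ) 2 :=
    memℓp_gen (by simpa using hψ.summable_sq_norm_taylorCoeffZero)
  set y : H := b.repr.symm ⟨taylorCoeffZero ψ, hmem⟩ with hy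
  have hby (n : ℕ) : ⟪b n, y⟫_ℂ = taylorCoeffZero ψ n := by
    rw [← b.repr_apply_apply, hy, LinearIsometryEquiv.apply_symm_apply]
  have hIco : Ico (0 : ℝ) 1 ∈ 𝓝[<] 1 := Ico_mem_nhdsLT zero_lt_one
  refine ⟨y, tendsto_of_tendsto_inner_hilbertBasis_of_dominated b
    hψ.summable_sq_norm_taylorCoeffZero (fun n => ?_) ?_⟩
  · rw [hby]
    refine (tendsto_mul_ofReal_pow_nhdsLT_one _ n).congr' ?_
    filter_upwards [hIco] with r hr using (hT.inner_basis_hInftyDilation hψ.1 hr n).symm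
  · filter_upwards [hIco] with r hr n
    have hrn : ‖(r : ℂ) ^ n - 1‖ ≤ 1 := by
      rw [← Complex.ofReal_pow, ← Complex.ofReal_one, ← Complex.ofReal_sub, Complex.norm_real,
        Real.norm_eq_abs, abs_le]
      constructor <;> linarith [pow_nonneg hr.1 n, pow_le_one₀ hr.1 hr.2.le (n := n)]
    rw [inner_sub_right, hby, hT.inner_basis_hInftyDilation hψ.1 hr, ← mul_sub_one, norm_mul]
    exact mul_le_of_le_one_right (norm_nonneg _) hrn

theorem IsUnilateralShift.exists_tendsto_hInftyDilation_basis (hT : IsUnilateralShift b T)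
    (hψ : MemHInfty ψ) (k : ℕ) :
    ∃ y, Tendsto (fun r => hInftyDilation ψ T r (b k)) (𝓝[<] 1) (𝓝 y) := by
  obtain ⟨y, hy⟩ := hT.exists_tendsto_hInftyDilation_basis_zero hψ
  refine ⟨(T ^ k) y, (((T ^ k).continuous.tendsto y).comp hy).congr' ?_⟩
  filter_upwards [Ico_mem_nhdsLT zero_lt_one] with r hr
  have hcomm := hInftyDilation_commute_pow (hT.summable_norm_taylorCoeffZero_smul_pow hψ.1 hr) k
  rw [Function.comp_apply, ← mul_apply_eq_comp, ← hcomm.eq, mul_apply_eq_comp,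
    hT.pow_apply_basis, zero_add]

theorem IsUnilateralShift.exists_isHInftyValue (hT : IsUnilateralShift b T) (hψ : MemHInfty ψ) :
    ∃ A, IsHInftyValue ψ T A := by
  obtain ⟨C, hC⟩ := hψ.2
  have hbound : ∀ᶠ r in 𝓝[<] 1, ‖hInftyDilation ψ T r‖ ≤ C := by
    filter_upwards [Ico_mem_nhdsLT zero_lt_one] with r hr using hT.norm_hInftyDilation_le hψ.1 hC hr
  have hlim (x : H) : ∃ y, Tendsto (fun r => hInftyDilation ψ T r x) (𝓝[<] 1) (𝓝 y) :=
    exists_tendsto_of_mem_closure hbound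
      (fun _ => exists_tendsto_of_mem_span
        (forall_mem_range.2 (hT.exists_tendsto_hInftyDilation_basis hψ)))
      (dense_span_range_hilbertBasis b x)
  choose A hA using hlim
  exact ⟨continuousLinearMapOfTendsto (hInftyDilation ψ T) (tendsto_pi_nhds.2 hA),
    fun _ hr0 hr1 => hT.summable_norm_taylorCoeffZero_smul_pow hψ.1 ⟨hr0, hr1⟩, hA⟩

end HInftyCalculus

section FrameVectors

variable {H : Type*} [NormedAddCommGroup H] [InnerProductSpace ℂ H] {b : HilbertBasis ℕ ℂ H}
  {T : H →L[ℂ] H}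

theorem norm_sq_le_mul_norm_sq_of_norm_le {E F : Type*} [SeminormedAddCommGroup E]
    [SeminormedAddCommGroup F] {x : E} {y : F} {C : ℝ} (h : ‖x‖ ≤ C * ‖y‖) :
    ‖x‖ ^ 2 ≤ (C ^ 2 + 1) * ‖y‖ ^ 2 :=
  calc ‖x‖ ^ 2 ≤ (C * ‖y‖) ^ 2 := by gcongr
    _ ≤ (C ^ 2 + 1) * ‖y‖ ^ 2 := by nlinarith [sq_nonneg ‖y‖]

theorem isFrameVector_of_pow_apply_eq_apply_basis [CompleteSpace H] {A B : H →L[ℂ] H} {f : H}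
    (hAB : A * B = 1) (hf : ∀ n, (T ^ n) f = A (b n)) : IsFrameVector T f := by
  have hsum (x : H) :
      HasSum (fun n => ‖⟪x, (T ^ n) f⟫_ℂ‖ ^ 2) (‖ContinuousLinearMap.adjoint A x‖ ^ 2) := by
    refine (hasSum_norm_inner_hilbertBasis_sq b _).congr_fun fun n => ?_
    rw [hf, ContinuousLinearMap.adjoint_inner_right, norm_inner_symm]
  have hBA : ContinuousLinearMap.adjoint B * ContinuousLinearMap.adjoint A = 1 := by
    simpa only [star_mul, star_one, ContinuousLinearMap.star_eq_adjoint] using congrArg star hAB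
  have hinv (x : H) : ContinuousLinearMap.adjoint B (ContinuousLinearMap.adjoint A x) = x :=
    DFunLike.congr_fun hBA x
  refine ⟨(‖B‖ ^ 2 + 1)⁻¹, ‖A‖ ^ 2 + 1, by positivity, by positivity, fun x =>
    ⟨(hsum x).summable, ?_, ?_⟩⟩
  · rw [(hsum x).tsum_eq, inv_mul_le_iff₀ (by positivity)]
    refine norm_sq_le_mul_norm_sq_of_norm_le ?_
    simpa only [hinv, LinearIsometryEquiv.norm_map] using
      (ContinuousLinearMap.adjoint B).le_opNorm (ContinuousLinearMap.adjoint A x)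
  · rw [(hsum x).tsum_eq]
    refine norm_sq_le_mul_norm_sq_of_norm_le ?_
    simpa only [LinearIsometryEquiv.norm_map] using (ContinuousLinearMap.adjoint A).le_opNorm x

variable [CompleteSpace H]

theorem IsUnilateralShift.hasSum_norm_inner_szegoKernel_pow_sq (hT : IsUnilateralShift b T) {w : ℂ}
    (hw : ‖w‖ < 1) (f : H) :
    HasSum (fun n => ‖⟪szegoKernel b w, (T ^ n) f⟫_ℂ‖ ^ 2)
      (‖szegoKernel b w‖ ^ 2 * ‖⟪szegoKernel b w, f⟫_ℂ‖ ^ 2) := by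
  refine ((hasSum_norm_inner_hilbertBasis_sq b _).mul_right _).congr_fun fun n => ?_
  rw [inner_pow_apply_of_inner_apply (hT.inner_szegoKernel_apply hw), norm_mul, mul_pow,
    norm_inner_symm (b n), inner_szegoKernel_basis hw]

theorem IsFrameVector.exists_norm_inner_szegoKernel_sq_bounds {f : H} (hf : IsFrameVector T f)
    (hT : IsUnilateralShift b T) :
    ∃ c₁ > 0, ∃ c₂, ∀ w : ℂ, ‖w‖ < 1 →
      c₁ ≤ ‖⟪szegoKernel b w, f⟫_ℂ‖ ^ 2 ∧ ‖⟪szegoKernel b w, f⟫_ℂ‖ ^ 2 ≤ c₂ := by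
  obtain ⟨c₁, c₂, hc₁, -, hbounds⟩ := hf
  refine ⟨c₁, hc₁, c₂, fun w hw => ?_⟩
  have hpos : 0 < ‖szegoKernel b w‖ ^ 2 := pow_pos (norm_pos_iff.2 (szegoKernel_ne_zero hw)) 2
  obtain ⟨-, hlower, hupper⟩ := hbounds (szegoKernel b w)
  rw [(hT.hasSum_norm_inner_szegoKernel_pow_sq hw f).tsum_eq] at hlower hupper
  rw [mul_comm c₁] at hlower
  rw [mul_comm c₂] at hupper
  exact ⟨le_of_mul_le_mul_left hlower hpos, le_of_mul_le_mul_left hupper hpos⟩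

theorem memHInfty_of_norm_sq_le {ψ : ℂ → ℂ} (hψ : DifferentiableOn ℂ ψ (Metric.ball 0 1)) {c : ℝ}
    (hc : ∀ z ∈ Metric.ball (0 : ℂ) 1, ‖ψ z‖ ^ 2 ≤ c) : MemHInfty ψ :=
  ⟨hψ, √c, fun z hz => Real.le_sqrt_of_sq_le (hc z hz)⟩

theorem ne_zero_of_le_norm_sq {E : Type*} [SeminormedAddCommGroup E] {x : E} {c : ℝ} (hc0 : 0 < c)
    (hc : c ≤ ‖x‖ ^ 2) : x ≠ 0 := by
  rintro rfl
  rw [norm_zero, zero_pow two_ne_zero] at hc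
  exact hc.not_gt hc0

theorem memHInfty_one_div_of_le_norm_sq {ψ : ℂ → ℂ}
    (hψ : DifferentiableOn ℂ ψ (Metric.ball 0 1)) {c : ℝ} (hc0 : 0 < c)
    (hc : ∀ z ∈ Metric.ball (0 : ℂ) 1, c ≤ ‖ψ z‖ ^ 2) : MemHInfty fun z => 1 / ψ z := by
  refine memHInfty_of_norm_sq_le (c := c⁻¹)
    ((differentiableOn_const 1).div hψ fun z hz => ne_zero_of_le_norm_sq hc0 (hc z hz))
    fun z hz => ?_
  rw [norm_div, norm_one, one_div, inv_pow]
  exact inv_anti₀ hc0 (hc z hz)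

variable {φ ψ : ℂ → ℂ}

theorem IsUnilateralShift.isHInftyValue_hInftyCalculus (hT : IsUnilateralShift b T)
    (hψ : MemHInfty ψ) : IsHInftyValue ψ T (hInftyCalculus ψ T) :=
  _root_.isHInftyValue_hInftyCalculus (hT.exists_isHInftyValue hψ)

theorem IsUnilateralShift.inner_szegoKernel_hInftyCalculus (hT : IsUnilateralShift b T)
    (hψ : MemHInfty ψ) {w : ℂ} (hw : ‖w‖ < 1) (x : H) :
    ⟪szegoKernel b w, hInftyCalculus ψ T x⟫_ℂ = ψ w * ⟪szegoKernel b w, x⟫_ℂ :=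
  (hT.isHInftyValue_hInftyCalculus hψ).inner_apply_of_inner_apply hψ.1 hw
    (hT.inner_szegoKernel_apply hw) x

theorem IsUnilateralShift.hInftyCalculus_mul_hInftyCalculus_eq_one (hT : IsUnilateralShift b T)
    (hφ : MemHInfty φ) (hψ : MemHInfty ψ) (hφψ : ∀ z ∈ Metric.ball (0 : ℂ) 1, φ z * ψ z = 1) :
    hInftyCalculus φ T * hInftyCalculus ψ T = 1 := by
  ext x
  refine ext_inner_szegoKernel (b := b) fun w hw => ?_
  rw [mul_apply_eq_comp, hT.inner_szegoKernel_hInftyCalculus hφ hw,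
    hT.inner_szegoKernel_hInftyCalculus hψ hw, ← mul_assoc, hφψ w (mem_ball_zero_iff.2 hw),
    one_mul, one_apply_eq_self]

theorem IsUnilateralShift.pow_apply_hInftyCalculus_basis_zero (hT : IsUnilateralShift b T)
    (hψ : MemHInfty ψ) (n : ℕ) :
    (T ^ n) (hInftyCalculus ψ T (b 0)) = hInftyCalculus ψ T (b n) := by
  refine ext_inner_szegoKernel (b := b) fun w hw => ?_
  rw [inner_pow_apply_of_inner_apply (hT.inner_szegoKernel_apply hw),
    hT.inner_szegoKernel_hInftyCalculus hψ hw, hT.inner_szegoKernel_hInftyCalculus hψ hw,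
    inner_szegoKernel_basis hw, inner_szegoKernel_basis hw, pow_zero, mul_one, mul_comm]

theorem IsUnilateralShift.hInftyCalculus_inner_szegoKernel_basis_zero
    (hT : IsUnilateralShift b T) {f : H} (hf : MemHInfty fun w => ⟪szegoKernel b w, f⟫_ℂ) :
    hInftyCalculus (fun w => ⟪szegoKernel b w, f⟫_ℂ) T (b 0) = f := by
  refine ext_inner_szegoKernel (b := b) fun w hw => ?_
  rw [hT.inner_szegoKernel_hInftyCalculus hf hw, inner_szegoKernel_basis hw, pow_zero, mul_one]

theorem IsUnilateralShift.isFrameVector_hInftyCalculus_basis_zero (hT : IsUnilateralShift b T)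
    (hψ : MemHInfty ψ) (hne : ∀ z ∈ Metric.ball (0 : ℂ) 1, ψ z ≠ 0)
    (hinv : MemHInfty fun z => 1 / ψ z) : IsFrameVector T (hInftyCalculus ψ T (b 0)) :=
  isFrameVector_of_pow_apply_eq_apply_basis
    (hT.hInftyCalculus_mul_hInftyCalculus_eq_one hψ hinv fun z hz => mul_one_div_cancel (hne z hz))
    (hT.pow_apply_hInftyCalculus_basis_zero hψ)

end FrameVectors

section Moments

variable {E : Type*} [NormedAddCommGroup E] [NormedSpace ℝ E] {μ : Measure ℝ} {a b : ℝ} {g : ℝ → E}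

theorem integrable_continuous_smul (hμ : ∀ᵐ x ∂μ, x ∈ Icc a b) (hg : Integrable g μ) {φ : ℝ → ℝ}
    (hφ : Continuous φ) : Integrable (fun x => φ x • g x) μ := by
  obtain ⟨C, hC⟩ := isCompact_Icc.exists_bound_of_continuousOn (s := Icc a b) hφ.continuousOn
  exact hg.bdd_smul C hφ.aestronglyMeasurable (hμ.mono hC)

theorem integral_polynomial_smul_eq_zero (hμ : ∀ᵐ x ∂μ, x ∈ Icc a b) (hg : Integrable g μ)
    (h : ∀ n : ℕ, ∫ x, x ^ n • g x ∂μ = 0) (p : Polynomial ℝ) : ∫ x, p.eval x • g x ∂μ = 0 := by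
  induction p using Polynomial.induction_on' with
  | add p q hp hq =>
    simp only [Polynomial.eval_add, add_smul]
    rw [integral_add (integrable_continuous_smul hμ hg p.continuous)
      (integrable_continuous_smul hμ hg q.continuous), hp, hq, add_zero]
  | monomial n c =>
    simp only [Polynomial.eval_monomial, mul_smul]
    rw [integral_smul, h, smul_zero]

theorem integral_continuous_smul_eq_zero (hμ : ∀ᵐ x ∂μ, x ∈ Icc a b) (hg : Integrable g μ)
    (h : ∀ n : ℕ, ∫ x, x ^ n • g x ∂μ = 0) {φ : ℝ → ℝ} (hφ : Continuous φ) :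
    ∫ x, φ x • g x ∂μ = 0 := by
  rw [← norm_le_zero_iff]
  refine le_of_forall_pos_le_add fun ε hε => ?_
  set M := ∫ x, ‖g x‖ ∂μ
  have hM : 0 ≤ M := integral_nonneg fun _ => norm_nonneg _
  obtain ⟨p, hp⟩ := exists_polynomial_near_of_continuousOn a b φ hφ.continuousOn
    (ε / (M + 1)) (by positivity)
  calc ‖∫ x, φ x • g x ∂μ‖ = ‖∫ x, (φ x - p.eval x) • g x ∂μ‖ := by
        simp only [sub_smul]
        rw [integral_sub (integrable_continuous_smul hμ hg hφ)
          (integrable_continuous_smul hμ hg p.continuous),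
          integral_polynomial_smul_eq_zero hμ hg h, sub_zero]
    _ ≤ ∫ x, ε / (M + 1) * ‖g x‖ ∂μ := by
        refine norm_integral_le_of_norm_le (hg.norm.const_mul _) (hμ.mono fun x hx => ?_)
        rw [norm_smul, Real.norm_eq_abs, abs_sub_comm]
        gcongr
        exact (hp x hx).le
    _ = ε / (M + 1) * M := integral_const_mul _ _
    _ ≤ ε / (M + 1) * (M + 1) := by gcongr; linarith
    _ = 0 + ε := by field_simp; ring

theorem ae_eq_zero_of_integral_pow_smul_eq_zero [CompleteSpace E] (hμ : ∀ᵐ x ∂μ, x ∈ Icc a b)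
    (hg : Integrable g μ) (h : ∀ n : ℕ, ∫ x, x ^ n • g x ∂μ = 0) : g =ᵐ[μ] 0 :=
  ae_eq_zero_of_integral_contDiff_smul_eq_zero hg.locallyIntegrable fun _ hφ _ =>
    integral_continuous_smul_eq_zero hμ hg h hφ.continuous

end Moments

section WanderingVector

variable {𝕜 E : Type*} [RCLike 𝕜] [NormedAddCommGroup E] [InnerProductSpace 𝕜 E] {T : E →L[𝕜] E}

theorem inner_pow_apply_pow_apply (hT : ∀ x y, ⟪T x, T y⟫_𝕜 = ⟪x, y⟫_𝕜) (n : ℕ) (x y : E) :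
    ⟪(T ^ n) x, (T ^ n) y⟫_𝕜 = ⟪x, y⟫_𝕜 := by
  induction n with
  | zero => rw [pow_zero, one_apply_eq_self, one_apply_eq_self]
  | succ n ih => rw [pow_succ', mul_apply_eq_comp, mul_apply_eq_comp, hT, ih]

theorem orthonormal_orbit_of_inner_range_eq_zero (hT : ∀ x y, ⟪T x, T y⟫_𝕜 = ⟪x, y⟫_𝕜) {v : E}
    (hv : ‖v‖ = 1) (hv_range : ∀ x, ⟪v, T x⟫_𝕜 = 0) : Orthonormal 𝕜 fun n : ℕ => (T ^ n) v := by
  have hlt {m n : ℕ} (hmn : m < n) : ⟪(T ^ m) v, (T ^ n) v⟫_𝕜 = 0 := by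
    obtain ⟨k, rfl⟩ := Nat.exists_eq_add_of_lt hmn
    rw [add_assoc, pow_add, mul_apply_eq_comp, inner_pow_apply_pow_apply hT, pow_succ',
      mul_apply_eq_comp, hv_range]
  refine ⟨fun n => ?_, fun m n hmn => ?_⟩
  · rw [@norm_eq_sqrt_re_inner 𝕜, inner_pow_apply_pow_apply hT, ← norm_eq_sqrt_re_inner, hv]
  · exact hmn.lt_or_gt.elim hlt fun h => inner_eq_zero_symm.1 (hlt h)

end WanderingVector

section NeumannSeries

variable {𝕜 E : Type*} [NontriviallyNormedField 𝕜] [NormedAddCommGroup E] [NormedSpace 𝕜 E]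
  [CompleteSpace E]

theorem hasSum_pow_apply_of_eq_add_apply {S : E →L[𝕜] E} (hS : ‖S‖ < 1) {x y : E}
    (h : x = y + S x) : HasSum (fun n => (S ^ n) y) x := by
  have hy : y = (1 - S) x := by rw [sub_apply, one_apply_eq_self, eq_sub_iff_add_eq, ← h]
  have hx : (∑' n, S ^ n) y = x := by
    rw [hy, ← mul_apply_eq_comp, geom_series_mul_neg S hS, one_apply_eq_self]
  simpa only [hx, ContinuousLinearMap.apply_apply] using
    (summable_geometric_of_norm_lt_one hS).hasSum.mapL (ContinuousLinearMap.apply 𝕜 E y)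

end NeumannSeries

section Monomials

theorem memLp_monomial (k : ℕ) :
    MemLp (fun x : ℝ => (x : ℂ) ^ k) 2 (volume.restrict (Ioo (0 : ℝ) 1)) := by
  refine MemLp.of_bound (Continuous.aestronglyMeasurable (by fun_prop)) 1 ?_
  filter_upwards [ae_restrict_mem measurableSet_Ioo] with x hx
  rw [norm_pow, Complex.norm_real, Real.norm_of_nonneg hx.1.le]
  exact pow_le_one₀ hx.1.le hx.2.le

/-- The function `x ↦ xᵏ` in `L²(0,1)`. -/
def monomialUnit (k : ℕ) : L2Unit := (memLp_monomial k).toLp _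

theorem coeFn_monomialUnit (k : ℕ) :
    monomialUnit k =ᵐ[volume.restrict (Ioo (0 : ℝ) 1)] fun x : ℝ => (x : ℂ) ^ k :=
  (memLp_monomial k).coeFn_toLp

theorem monomialUnit_zero : monomialUnit 0 = chiUnit := by
  refine Lp.ext ((coeFn_monomialUnit 0).trans ?_)
  filter_upwards [Lp.coeFn_const 2 (volume.restrict (Ioo (0 : ℝ) 1)) (1 : ℂ)] with x hx
  rw [chiUnit, hx, pow_zero, Function.const_apply]

theorem inner_monomialUnit (k : ℕ) (f : L2Unit) :
    ⟪monomialUnit k, f⟫_ℂ = ∫ x in Ioo (0 : ℝ) 1, x ^ k • f x := by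
  rw [L2.inner_def]
  refine integral_congr_ae ?_
  filter_upwards [coeFn_monomialUnit k] with x hx
  rw [hx, RCLike.inner_apply, map_pow, Complex.conj_ofReal, mul_comm, Complex.real_smul,
    Complex.ofReal_pow]

theorem inner_monomialUnit_monomialUnit (j k : ℕ) :
    ⟪monomialUnit j, monomialUnit k⟫_ℂ = 1 / ((j : ℂ) + k + 1) := by
  have hjk : ∫ x in Ioo (0 : ℝ) 1, x ^ j • monomialUnit k x =
      ∫ x in Ioo (0 : ℝ) 1, ((x ^ (j + k) : ℝ) : ℂ) := by
    refine integral_congr_ae ?_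
    filter_upwards [coeFn_monomialUnit k] with x hx
    rw [hx, pow_add, Complex.real_smul, Complex.ofReal_mul, Complex.ofReal_pow x k]
  rw [inner_monomialUnit, hjk, integral_complex_ofReal, ← integral_Ioc_eq_integral_Ioo,
    ← intervalIntegral.integral_of_le zero_le_one, integral_pow]
  simp

theorem norm_chiUnit : ‖chiUnit‖ = 1 := by
  have h := inner_monomialUnit_monomialUnit 0 0
  rw [monomialUnit_zero, inner_self_eq_norm_sq_to_K] at h
  have hsq : ‖chiUnit‖ ^ 2 = 1 := by
    have : ((‖chiUnit‖ ^ 2 : ℝ) : ℂ) = 1 := by simpa using h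
    exact_mod_cast this
  exact (pow_eq_one_iff_of_nonneg (norm_nonneg _) two_ne_zero).1 hsq

theorem eq_zero_of_inner_monomialUnit_succ_eq_zero {f : L2Unit}
    (h : ∀ k, ⟪monomialUnit (k + 1), f⟫_ℂ = 0) : f = 0 := by
  have hunit : ∀ᵐ x ∂volume.restrict (Ioo (0 : ℝ) 1), x ∈ Icc (0 : ℝ) 1 :=
    (ae_restrict_mem measurableSet_Ioo).mono fun _ hx => Ioo_subset_Icc_self hx
  have hf : Integrable (fun x : ℝ => x • f x) (volume.restrict (Ioo (0 : ℝ) 1)) :=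
    integrable_continuous_smul hunit ((Lp.memLp f).integrable (by norm_num)) continuous_id
  have hae := ae_eq_zero_of_integral_pow_smul_eq_zero hunit hf fun n => by
    simpa only [smul_smul, ← pow_succ, inner_monomialUnit] using h n
  refine (Lp.eq_zero_iff_ae_eq_zero).2 ?_
  filter_upwards [hae, ae_restrict_mem measurableSet_Ioo] with x hx hx_mem
  exact (smul_eq_zero.1 hx).resolve_left hx_mem.1.ne'

theorem ext_inner_monomialUnit_succ {f g : L2Unit}
    (h : ∀ k, ⟪monomialUnit (k + 1), f⟫_ℂ = ⟪monomialUnit (k + 1), g⟫_ℂ) : f = g :=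
  sub_eq_zero.1 <| eq_zero_of_inner_monomialUnit_succ_eq_zero fun k => by
    rw [inner_sub_right, h, sub_self]

end Monomials

section HardyShift

theorem hardyOperator_monomialUnit (k : ℕ) :
    hardyOperator (monomialUnit k) = (1 / ((k : ℂ) + 1)) • monomialUnit k := by
  refine Lp.ext ((memLp_hardyAverage _).coeFn_toLp.trans ?_)
  filter_upwards [ae_restrict_mem measurableSet_Ioo, coeFn_monomialUnit k,
    Lp.coeFn_smul (1 / ((k : ℂ) + 1)) (monomialUnit k)] with x hx hmono hsmul
  have hint : ∫ t in (0 : ℝ)..x, monomialUnit k t = ∫ t in (0 : ℝ)..x, ((t ^ k : ℝ) : ℂ) := by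
    refine intervalIntegral.integral_congr_ae ?_
    filter_upwards [ae_imp_of_ae_restrict (coeFn_monomialUnit k)] with t ht htx
    rw [uIoc_of_le hx.1.le] at htx
    rw [ht ⟨htx.1, htx.2.trans_lt hx.2⟩, Complex.ofReal_pow]
  have hx0 : (x : ℂ) ≠ 0 := Complex.ofReal_ne_zero.2 hx.1.ne'
  rw [hsmul, Pi.smul_apply, hmono, hardyAverage, hint, intervalIntegral.integral_ofReal,
    integral_pow, smul_eq_mul, zero_pow k.succ_ne_zero, sub_zero]
  push_cast
  field_simp
  ring

theorem hardyOperator_chiUnit : hardyOperator chiUnit = chiUnit := by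
  rw [← monomialUnit_zero, hardyOperator_monomialUnit, Nat.cast_zero, zero_add, div_one, one_smul]

/-- The operator `I - H₁*`. -/
def hardyShift : L2Unit →L[ℂ] L2Unit := 1 - ContinuousLinearMap.adjoint hardyOperator

theorem adjoint_hardyShift : ContinuousLinearMap.adjoint hardyShift = 1 - hardyOperator := by
  rw [hardyShift, map_sub, ContinuousLinearMap.adjoint_adjoint,
    ← ContinuousLinearMap.star_eq_adjoint, star_one]

theorem inner_hardyShift_right (f g : L2Unit) :
    ⟪f, hardyShift g⟫_ℂ = ⟪f - hardyOperator f, g⟫_ℂ := by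
  rw [← ContinuousLinearMap.adjoint_inner_left, adjoint_hardyShift, sub_apply, one_apply_eq_self]

theorem hardyShift_monomialUnit_succ (k : ℕ) :
    hardyShift (monomialUnit (k + 1)) =
      (((k : ℂ) + 2) / (k + 1)) • monomialUnit (k + 1) - (1 / ((k : ℂ) + 1)) • chiUnit := by
  refine ext_inner_monomialUnit_succ fun j => ?_
  have hk : (k : ℂ) + 1 ≠ 0 := Nat.cast_add_one_ne_zero k
  have hj : (j : ℂ) + 1 + 1 ≠ 0 := by exact_mod_cast Nat.succ_ne_zero (j + 1)
  have hjk : (j : ℂ) + 1 + (k + 1) + 1 ≠ 0 := by exact_mod_cast Nat.succ_ne_zero (j + 1 + (k + 1))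
  rw [inner_hardyShift_right, hardyOperator_monomialUnit, inner_sub_left, inner_sub_right,
    inner_smul_left, inner_smul_right, inner_smul_right, ← monomialUnit_zero,
    inner_monomialUnit_monomialUnit, inner_monomialUnit_monomialUnit]
  simp only [map_div₀, map_add, map_one, Complex.conj_natCast, Nat.cast_zero, Nat.cast_succ,
    add_zero]
  field_simp
  ring

theorem hardyShift_sub_hardyOperator_hardyShift (f : L2Unit) :
    hardyShift f - hardyOperator (hardyShift f) = f := by
  suffices h : ContinuousLinearMap.adjoint hardyShift (hardyShift f) = f by
    rwa [adjoint_hardyShift] at h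
  refine ext_inner_monomialUnit_succ fun k => ?_
  have hk : (k : ℂ) + 1 ≠ 0 := Nat.cast_add_one_ne_zero k
  have hk' : (k : ℂ) + 1 + 1 ≠ 0 := by exact_mod_cast Nat.succ_ne_zero (k + 1)
  rw [ContinuousLinearMap.adjoint_inner_right, inner_hardyShift_right]
  congr 1
  rw [hardyShift_monomialUnit_succ, map_sub, map_smul, map_smul, hardyOperator_monomialUnit,
    hardyOperator_chiUnit, smul_smul, sub_sub_sub_cancel_right, ← sub_smul]
  convert one_smul ℂ (monomialUnit (k + 1)) using 2
  push_cast
  field_simp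
  ring

theorem inner_hardyShift_hardyShift (f g : L2Unit) :
    ⟪hardyShift f, hardyShift g⟫_ℂ = ⟪f, g⟫_ℂ := by
  rw [inner_hardyShift_right, hardyShift_sub_hardyOperator_hardyShift]

theorem norm_hardyShift_le_one : ‖hardyShift‖ ≤ 1 :=
  ContinuousLinearMap.opNorm_le_bound _ zero_le_one fun f => by
    rw [one_mul, @norm_eq_sqrt_re_inner ℂ, inner_hardyShift_hardyShift, ← norm_eq_sqrt_re_inner]

theorem inner_chiUnit_hardyShift (f : L2Unit) : ⟪chiUnit, hardyShift f⟫_ℂ = 0 := by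
  rw [inner_hardyShift_right, hardyOperator_chiUnit, sub_self, inner_zero_left]

theorem orthonormal_hardyShift_orbit : Orthonormal ℂ fun n : ℕ => (hardyShift ^ n) chiUnit :=
  orthonormal_orbit_of_inner_range_eq_zero inner_hardyShift_hardyShift norm_chiUnit
    inner_chiUnit_hardyShift

theorem hasSum_hardyShift_orbit_monomialUnit_succ (k : ℕ) :
    HasSum (fun n => ((((k : ℂ) + 1) / (k + 2)) ^ n * (1 / ((k : ℂ) + 2))) •
      (hardyShift ^ n) chiUnit) (monomialUnit (k + 1)) := by
  have hk : (k : ℂ) + 1 ≠ 0 := Nat.cast_add_one_ne_zero k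
  have hk' : (k : ℂ) + 2 ≠ 0 := by exact_mod_cast Nat.succ_ne_zero (k + 1)
  have hratio : ‖((k : ℂ) + 1) / (k + 2)‖ < 1 := by
    have h : ((k : ℂ) + 1) / (k + 2) = (((k : ℝ) + 1) / (k + 2) : ℝ) := by push_cast; rfl
    rw [h, Complex.norm_real, Real.norm_of_nonneg (by positivity), div_lt_one (by positivity)]
    linarith
  have hnorm : ‖(((k : ℂ) + 1) / (k + 2)) • hardyShift‖ < 1 := by
    rw [norm_smul]
    exact (mul_le_of_le_one_right (norm_nonneg _) norm_hardyShift_le_one).trans_lt hratio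
  have hfix : monomialUnit (k + 1) = (1 / ((k : ℂ) + 2)) • chiUnit +
      ((((k : ℂ) + 1) / (k + 2)) • hardyShift) (monomialUnit (k + 1)) := by
    rw [smul_apply, hardyShift_monomialUnit_succ, smul_sub, smul_smul, smul_smul,
      div_mul_div_cancel₀' hk, div_self hk', one_smul, div_mul_div_cancel₀' hk]
    abel
  refine (hasSum_pow_apply_of_eq_add_apply hnorm hfix).congr_fun fun n => ?_
  rw [smul_pow, smul_apply, map_smul, smul_smul]

theorem eq_zero_of_inner_hardyShift_orbit_eq_zero {f : L2Unit}
    (h : ∀ n : ℕ, ⟪f, (hardyShift ^ n) chiUnit⟫_ℂ = 0) : f = 0 := by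
  refine eq_zero_of_inner_monomialUnit_succ_eq_zero fun k => inner_eq_zero_symm.1 ?_
  refine ((hasSum_hardyShift_orbit_monomialUnit_succ k).mapL (innerSL ℂ f)).unique ?_
  simpa only [innerSL_apply_apply, inner_smul_right, h, mul_zero] using hasSum_zero

/-- The orbit of `χ` under `I - H₁*`, as an orthonormal basis of `L²(0,1)`. It exhibits `I - H₁*`
as a unilateral shift. -/
def hardyShiftBasis : HilbertBasis ℕ ℂ L2Unit :=
  HilbertBasis.mkOfOrthogonalEqBot orthonormal_hardyShift_orbit <|
    (Submodule.eq_bot_iff _).2 fun _ hf => eq_zero_of_inner_hardyShift_orbit_eq_zero fun n =>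
      (Submodule.mem_orthogonal' _ _).1 hf _ (Submodule.subset_span (mem_range_self n))

theorem hardyShiftBasis_apply (n : ℕ) : hardyShiftBasis n = (hardyShift ^ n) chiUnit :=
  congrFun (HilbertBasis.coe_mkOfOrthogonalEqBot _ _) n

theorem hardyShiftBasis_zero : hardyShiftBasis 0 = chiUnit := by
  rw [hardyShiftBasis_apply, pow_zero, one_apply_eq_self]

theorem isUnilateralShift_hardyShift : IsUnilateralShift hardyShiftBasis hardyShift := fun n => by
  rw [hardyShiftBasis_apply, hardyShiftBasis_apply, pow_succ', mul_apply_eq_comp]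

end HardyShift

end

theorem mainTheorem9_general {H : Type*} [NormedAddCommGroup H] [InnerProductSpace ℂ H]
    [CompleteSpace H] {b : HilbertBasis ℕ ℂ H} {T : H →L[ℂ] H} (hT : IsUnilateralShift b T) :
    (∀ ψ : ℂ → ℂ, MemHInfty ψ → IsHInftyValue ψ T (hInftyCalculus ψ T)) ∧
    ∀ f : H, IsFrameVector T f ↔
      ∃ ψ : ℂ → ℂ, MemHInfty ψ ∧ (∀ z ∈ Metric.ball (0 : ℂ) 1, ψ z ≠ 0) ∧
        MemHInfty (fun z => 1 / ψ z) ∧ f = hInftyCalculus ψ T (b 0) := by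
  refine ⟨fun ψ hψ => hT.isHInftyValue_hInftyCalculus hψ, fun f => ⟨fun hf => ?_, ?_⟩⟩
  · obtain ⟨c₁, hc₁, c₂, hbounds⟩ := hf.exists_norm_inner_szegoKernel_sq_bounds hT
    have hd := differentiableOn_inner_szegoKernel (b := b) f
    have hlower (z : ℂ) (hz : z ∈ Metric.ball (0 : ℂ) 1) : c₁ ≤ ‖⟪szegoKernel b z, f⟫_ℂ‖ ^ 2 :=
      (hbounds z (mem_ball_zero_iff.1 hz)).1
    have hmem : MemHInfty fun w => ⟪szegoKernel b w, f⟫_ℂ :=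
      memHInfty_of_norm_sq_le hd fun z hz => (hbounds z (mem_ball_zero_iff.1 hz)).2
    exact ⟨_, hmem, fun z hz => ne_zero_of_le_norm_sq hc₁ (hlower z hz),
      memHInfty_one_div_of_le_norm_sq hd hc₁ hlower,
      (hT.hInftyCalculus_inner_szegoKernel_basis_zero hmem).symm⟩
  · rintro ⟨ψ, hψ, hne, hinv, rfl⟩
    exact hT.isFrameVector_hInftyCalculus_basis_zero hψ hne hinv

theorem mainTheorem9 :
    (∀ ψ : ℂ → ℂ, MemHInfty ψ →
      IsHInftyValue ψ (1 - ContinuousLinearMap.adjoint hardyOperator)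
        (hInftyCalculus ψ (1 - ContinuousLinearMap.adjoint hardyOperator))) ∧
    ∀ f : L2Unit,
      IsFrameVector (1 - ContinuousLinearMap.adjoint hardyOperator) f ↔
        ∃ ψ : ℂ → ℂ, MemHInfty ψ ∧ (∀ z ∈ Metric.ball (0 : ℂ) 1, ψ z ≠ 0) ∧
          MemHInfty (fun z => 1 / ψ z) ∧
          f = hInftyCalculus ψ (1 - ContinuousLinearMap.adjoint hardyOperator) chiUnit := by
  rw [← hardyShiftBasis_zero]
  exact mainTheorem9_general isUnilateralShift_hardyShift
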